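/- **Notation.** For a real sequence $\mathbf s=\{s_i\}_{i\ge 0}$ put $S_n=(s_{i+j})_{i,j=0}^{n-1}$, $S_n^+=(s_{i+j+1})_{i,j=0}^{n-1}$, and let $\nu_-(\cdot)$ be the number of negative eigenvalues. The normal indices of $\mathbf s$ are the integers $n\ge 1$ with $\det S_n\neq 0$, enumerated as $n_1<n_2<\dots$. For $\kappa,k\in\mathbb Z_+$ write $\mathbf s\in\mathcal H_\kappa^{k,reg}$ if $\nu_-(S_n)=\kappa$ and $\nu_-(S_n^+)=k$ for all sufficiently large $n$, and $\det S_{n}^+\neq 0$ for every normal index $n$. *Schur algorithm.* Let $f=-\sum_{i\ge0}s_iz^{-i-1}$ as a formal series. If $s_0=\dots=s_{\nu-2}=0\ne s_{\nu-1}$, write $$-\frac1{f(z)}=z\,m_1(z)-\frac{1}{l_1+f_1(z)},\qquad f_1=-\sum_{i\ge 0}s^{(1)}_iz^{-i-1},$$ with $m_1$ a real polynomial of degree $\nu-1$ and $l_1\in\mathbb R\setminus\{0\}$; this defines $m_1,l_1$ and the first induced sequence $\mathbf s^{(1)}$. Repeating the step with $\mathbf s^{(j-1)}$ in place of $\mathbf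 s=\mathbf s^{(0)}$ defines $m_j,l_j$ and the $j$-th induced sequence $\mathbf s^{(j)}$. The generalized Stieltjes polynomials $P_i^+,Q_i^+$ are the solutions of $$y_{2j-1}-y_{2j-3}=-z\,m_j(z)\,y_{2j-2},\qquad y_{2j}-y_{2j-2}=l_j\,y_{2j-1}\qquad(j\ge1)$$ with $P^+_{-1}=0,\ P^+_0=1$ and $Q^+_{-1}=1,\ Q^+_0=0$. Put $$W_{2N}(z)=\begin{pmatrix}Q^+_{2N-1}(z)&Q^+_{2N}(z)\\P^+_{2N-1}(z)&P^+_{2N}(z)\end{pmatrix},\qquad T_W[\tau]=\frac{w_{11}\tau+w_{12}}{w_{21}\tau+w_{22}} .$$ *Padé approximants.* The $[L/M]$ Padé approximant of $-\sum_{i\ge0} s_iz^{-i-1}$ is a rational function $f^{[L/M]}(z)=A(1/z)/B(1/z)$ with polynomials $A,B$ of degree at most $L,M$, such that $B(0)\ne0$ and $$f^{[L/M]}(z)+\sum_{i=0}^{L+M}\frac{s_i}{z^{i+1}}=O\bigl(z^{-(L+M+1)}\bigr)$$ as $z\to\infty$ in every sector $\varepsilon<\arg z<\pi-\varepsilon$,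 $0<\varepsilon<\pi/2$. **Statement.** Let $\kappa,k\in\mathbb Z_+$, $\mathbf s\in\mathcal H_\kappa^{k,reg}$, $N\ge1$, and let $f^{[L/M]}$ and $g^{[L/M]}$ denote the Padé approximants of $-\sum_{i\ge0} s_iz^{-i-1}$ and of $-\sum_{i\ge0} s^{(N)}_iz^{-i-1}$, respectively. Then for every $j>N$ (such that $\mathbf s$ has at least $j$ normal indices, which is no restriction if it has infinitely many): (i) the approximants $f^{[n_j/n_j]}$ and $g^{[n_j-n_N/n_j-n_N]}$ exist and are unique, and $$f^{[n_j/n_j]}(z)=T_{W_{2N}(z)}\bigl[g^{[n_j-n_N/n_j-n_N]}(z)\bigr];$$ (ii) the approximants $f^{[n_j/n_j-1]}$ and $g^{[n_j-n_N/n_j-n_N-1]}$ exist and are unique, and $$f^{[n_j/n_j-1]}(z)=T_{W_{2N}(z)}\bigl[g^{[n_j-n_N/n_j-n_N-1]}(z)\bigr].$$ Both equalities are equalities of rational functions in $z$, and the denominators of the linear fractional transformations do not vanish identically. -/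

import Mathlib

namespace IndefStieltjes

open Polynomial Filter Asymptotics

/-- The Hankel matrix `S_n = (s_{i+j})_{i,j=0}^{n-1}`. -/
def hankel (s : ℕ → ℝ) (n : ℕ) : Matrix (Fin n) (Fin n) ℝ :=
  Matrix.of fun i j => s (i + j)

/-- The shifted sequence `{s_{j+1}}`, so that `S_n⁺ = hankel (shift s) n`. -/
def shift (s : ℕ → ℝ) : ℕ → ℝ := fun j => s (j + 1)

theorem hankel_isHermitian (s : ℕ → ℝ) (n : ℕ) : (hankel s n).IsHermitian := by
  ext i j
  simp [hankel, Nat.add_comm]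

/-- `ν₋(S_n)`: the number of negative eigenvalues of `S_n`, counted with multiplicity. -/
noncomputable def negIndex (s : ℕ → ℝ) (n : ℕ) : ℕ :=
  (Finset.univ.filter fun i => (hankel_isHermitian s n).eigenvalues i < 0).card

/-- The class `H_κ`. -/
def MemH (κ : ℕ) (s : ℕ → ℝ) : Prop := ∀ᶠ n in atTop, negIndex s n = κ

/-- The set `N(s)` of normal indices. -/
def normalIndices (s : ℕ → ℝ) : Set ℕ := {n | 1 ≤ n ∧ (hankel s n).det ≠ 0}

/-- The `j`-th normal index `n_j`. Since the empty determinant is `1`, the enumeration of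
`{n | det S_n ≠ 0}` starts with `n_0 = 0`, and `n_1 < n_2 < …` are the elements of `N(s)`. -/
noncomputable def normalIndex (s : ℕ → ℝ) (j : ℕ) : ℕ :=
  Nat.nth (fun n => (hankel s n).det ≠ 0) j

/-- The class `H_κ^{k,reg}` of regular sequences. -/
structure MemHReg (κ k : ℕ) (s : ℕ → ℝ) : Prop where
  mem : MemH κ s
  mem_shift : MemH k (shift s)
  regular : ∀ n ∈ normalIndices s, (hankel (shift s) n).det ≠ 0

/-! ### The Schur algorithm

For `f = -∑ s_j / z^(j+1)` with first normal index `ν`, i.e. `s_0 = … = s_{ν-2} = 0 ≠ s_{ν-1}`,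
one writes, with `w = 1/z`,
`-1/f = z^ν (c_0 + c_1 w + …) = z m(z) - 1/(l + f_1)`, where `m` is a polynomial, `l` a number
and `f_1 = -∑ s_j^{(1)} / z^(j+1)`. -/

/-- The first normal index of a nonzero sequence: `s_{ν-1}` is the first nonzero moment. -/
noncomputable def firstIndex (s : ℕ → ℝ) : ℕ := sInf {i | s i ≠ 0} + 1

/-- The series `c_0 + c_1 w + …`, inverse of `s_{ν-1} + s_ν w + …`. -/
noncomputable def recipSeries (s : ℕ → ℝ) : PowerSeries ℝ :=
  (PowerSeries.mk fun i => s (firstIndex s - 1 + i))⁻¹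

/-- `z m(z) = c_0 z^ν + … + c_{ν-1} z`. -/
noncomputable def schurM (s : ℕ → ℝ) : ℝ[X] :=
  ∑ i ∈ Finset.range (firstIndex s),
    monomial (firstIndex s - 1 - i) (PowerSeries.coeff i (recipSeries s))

/-- `-1/l = c_ν`. -/
noncomputable def schurL (s : ℕ → ℝ) : ℝ :=
  -1 / PowerSeries.coeff (firstIndex s) (recipSeries s)

/-- The first induced sequence: `l - ∑ s_i^{(1)} w^(i+1) = -(c_ν + c_{ν+1} w + …)⁻¹`. -/
noncomputable def schurNext (s : ℕ → ℝ) : ℕ → ℝ := fun i =>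
  PowerSeries.coeff (i + 1)
    (PowerSeries.mk fun r => PowerSeries.coeff (firstIndex s + r) (recipSeries s))⁻¹

/-- The `N`-th induced sequence `s^{(N)}`. -/
noncomputable def induced (s : ℕ → ℝ) (N : ℕ) : ℕ → ℝ := schurNext^[N] s

/-- The coefficient `m_j(z)`, `j ≥ 1`, of the generalized Stieltjes fraction. -/
noncomputable def mCoeff (s : ℕ → ℝ) (j : ℕ) : ℝ[X] := schurM (induced s (j - 1))

/-- The coefficient `l_j`, `j ≥ 1`, of the generalized Stieltjes fraction. -/
noncomputable def lCoeff (s : ℕ → ℝ) (j : ℕ) : ℝ := schurL (induced s (j - 1))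

/-- The pairs `(y_{2j-1}, y_{2j})` of the solution of
`y_{2j-1} - y_{2j-3} = -z m_j(z) y_{2j-2}`, `y_{2j} - y_{2j-2} = l_j y_{2j-1}` with given
initial values `(y_{-1}, y_0)`. -/
noncomputable def stieltjesSol (s : ℕ → ℝ) (init : ℝ[X] × ℝ[X]) : ℕ → ℝ[X] × ℝ[X]
  | 0 => init
  | j + 1 =>
    let y := stieltjesSol s init j
    let odd := y.1 - X * mCoeff s (j + 1) * y.2
    (odd, y.2 + C (lCoeff s (j + 1)) * odd)

/-- The pair `(P⁺_{2j-1}, P⁺_{2j})` of generalized Stieltjes polynomials of the first kind. -/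
noncomputable def stieltjesP (s : ℕ → ℝ) (j : ℕ) : ℝ[X] × ℝ[X] := stieltjesSol s (0, 1) j

/-- The pair `(Q⁺_{2j-1}, Q⁺_{2j})` of generalized Stieltjes polynomials of the second kind. -/
noncomputable def stieltjesQ (s : ℕ → ℝ) (j : ℕ) : ℝ[X] × ℝ[X] := stieltjesSol s (1, 0) j

/-- The resolvent matrix `W_{2N}(z)`. -/
noncomputable def resolventMatrix (s : ℕ → ℝ) (N : ℕ) : Matrix (Fin 2) (Fin 2) ℝ[X] :=
  !![(stieltjesQ s N).1, (stieltjesQ s N).2;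
     (stieltjesP s N).1, (stieltjesP s N).2]

/-- A real polynomial regarded as a complex rational function of `z`. -/
noncomputable def toRat (p : ℝ[X]) : RatFunc ℂ :=
  algebraMap ℂ[X] (RatFunc ℂ) (p.map Complex.ofRealHom)

/-- The denominator `w₂₁ τ + w₂₂` of `T_W[τ]`. -/
def lftDenom {K : Type*} [Field K] (W : Matrix (Fin 2) (Fin 2) K) (τ : K) : K :=
  W 1 0 * τ + W 1 1

/-- The linear fractional transformation `T_W[τ] = (w₁₁ τ + w₁₂) / (w₂₁ τ + w₂₂)`. -/
def lft {K : Type*} [Field K] (W : Matrix (Fin 2) (Fin 2) K) (τ : K) : K :=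
  (W 0 0 * τ + W 0 1) / lftDenom W τ

/-- `R(z) = A(1/z) / B(1/z)` is the `[L/M]` Padé approximant of `-∑ s_j / z^(j+1)`; the
asymptotic relation holds as `z → ∞` nontangentially, i.e. in each sector
`ε < arg z < π - ε`. -/
def IsPade (s : ℕ → ℝ) (L M : ℕ) (R : RatFunc ℂ) : Prop :=
  ∃ A B : ℂ[X], A.natDegree ≤ L ∧ B.natDegree ≤ M ∧ B.eval 0 ≠ 0 ∧
    R = aeval (RatFunc.X⁻¹ : RatFunc ℂ) A / aeval (RatFunc.X⁻¹ : RatFunc ℂ) B ∧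
    ∀ ε : ℝ, 0 < ε → ε < Real.pi / 2 →
      (fun z : ℂ => A.eval (1 / z) / B.eval (1 / z)
          + ∑ j ∈ Finset.range (L + M + 1), (s j : ℂ) / z ^ (j + 1))
        =O[Bornology.cobounded ℂ ⊓ 𝓟 {z : ℂ | ε < z.arg ∧ z.arg < Real.pi - ε}]
      (fun z : ℂ => 1 / z ^ (L + M + 1))

end IndefStieltjes

open IndefStieltjes

namespace IndefStieltjes

open Polynomial Filter Asymptotics

/-! Call `Q/P` an approximant of degree `n` and order `k` if `deg Q < deg P = n` and `f P - Q =
O(z^(-k))`. Writing `f = -1/(z m - 1/(l + f₁))` as a substitution on pairs, `(P, Q) ↦ (P - z m (Q +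
l P), Q + l P)`, one Schur step turns an approximant of `f₁` into one of `f` and raises both `n` and
`k` by `ν = deg (z m)`. Composing `N` steps gives `W_{2N}` (`Approximant.resolvent`).

Degeneracy of `S_n` is also an approximation property (`det_hankel_eq_zero_iff`), so a step shifts
normal indices by `ν`; hence `n_N` is the sum of the first `N` values of `ν` (`normal_schurOffset`).
Regularity makes each `l` finite and is inherited.

At a normal index `n`, descent along the steps yields an approximant of order `n + 1`, and one of
order `n` with `P(0) = 0`. Reversing coefficients turns these into the `[n/n]` and `[n/n-1]` Padé
approximants (`Approximant.isPade`). Uniqueness of Padé approximants (`IsPade.unique`) then forces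
the stated relations. -/

/-! ### Orders of Laurent series in `1/z`, and polynomials in `z` among them. -/

/-- The Laurent series `x` in `1/z` is `O(z^(-k))` as `z → ∞`. -/
def VanishBelow (k : ℤ) (x : LaurentSeries ℝ) : Prop := ∀ i < k, x.coeff i = 0

theorem vanishBelow_iff_le_orderTop {k : ℤ} {x : LaurentSeries ℝ} :
    VanishBelow k x ↔ (k : WithTop ℤ) ≤ x.orderTop := by
  rw [HahnSeries.le_orderTop_iff_forall]
  simp [VanishBelow]

theorem VanishBelow.mono {k l : ℤ} {x : LaurentSeries ℝ} (h : VanishBelow l x) (hkl : k ≤ l) :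
    VanishBelow k x := fun i hi => h i (hi.trans_le hkl)

theorem VanishBelow.add {k : ℤ} {x y : LaurentSeries ℝ} (hx : VanishBelow k x)
    (hy : VanishBelow k y) : VanishBelow k (x + y) := fun i hi => by
  simp [hx i hi, hy i hi]

theorem VanishBelow.neg {k : ℤ} {x : LaurentSeries ℝ} (hx : VanishBelow k x) :
    VanishBelow k (-x) := fun i hi => by simp [hx i hi]

theorem VanishBelow.sub {k : ℤ} {x y : LaurentSeries ℝ} (hx : VanishBelow k x)
    (hy : VanishBelow k y) : VanishBelow k (x - y) := fun i hi => by
  simp [hx i hi, hy i hi]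

theorem VanishBelow.mul {k l : ℤ} {x y : LaurentSeries ℝ} (hx : VanishBelow k x)
    (hy : VanishBelow l y) : VanishBelow (k + l) (x * y) := by
  rw [vanishBelow_iff_le_orderTop] at *
  rw [HahnSeries.orderTop_mul, WithTop.coe_add]
  exact add_le_add hx hy

theorem vanishBelow_ofPowerSeries (u : PowerSeries ℝ) :
    VanishBelow 0 (HahnSeries.ofPowerSeries ℤ ℝ u) := fun i hi => by
  rw [PowerSeries.coeff_coe, if_pos hi]

theorem vanishBelow_single {k : ℤ} (r : ℝ) : VanishBelow k (HahnSeries.single k r) :=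
  fun _ hi => HahnSeries.coeff_single_of_ne hi.ne

/-- Polynomials in `z` as Laurent series in `1/z`. -/
noncomputable def atInfty : ℝ[X] →ₐ[ℝ] LaurentSeries ℝ := aeval (HahnSeries.single (-1) 1)

theorem atInfty_monomial (k : ℕ) (r : ℝ) :
    atInfty (monomial k r) = HahnSeries.single (-k : ℤ) r := by
  rw [atInfty, aeval_monomial, HahnSeries.single_pow, HahnSeries.algebraMap_apply']
  simp [HahnSeries.C_apply]

theorem atInfty_C (r : ℝ) : atInfty (C r) = HahnSeries.C r := by
  rw [← monomial_zero_left, atInfty_monomial]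
  simp [HahnSeries.C_apply]

theorem atInfty_X : atInfty X = HahnSeries.single (-1) 1 := by simp [atInfty]

theorem coeff_atInfty (p : ℝ[X]) (n : ℤ) :
    (atInfty p).coeff n = if n ≤ 0 then p.coeff (-n).toNat else 0 := by
  induction p using Polynomial.induction_on' with
  | add p q hp hq =>
    rw [map_add, HahnSeries.coeff_add, hp, hq]
    split_ifs <;> simp
  | monomial k r =>
    rw [atInfty_monomial, HahnSeries.coeff_single, coeff_monomial]
    split_ifs <;> first | rfl | omega

/-- Degree bounds become order bounds, so degrees and approximation errors are handled by the same
calculus. -/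
theorem vanishBelow_atInfty_iff {p : ℝ[X]} {m : ℕ} :
    VanishBelow (1 - m) (atInfty p) ↔ p.degree < m := by
  rw [degree_lt_iff_coeff_zero]
  constructor
  · intro h k hk
    have := h (-k) (by omega)
    rw [coeff_atInfty, if_pos (by omega)] at this
    simpa using this
  · intro h i hi
    rw [coeff_atInfty]
    split_ifs
    · exact h _ (by omega)
    · rfl

theorem eq_zero_of_vanishBelow_one {p : ℝ[X]} (h : VanishBelow 1 (atInfty p)) : p = 0 := by
  have : p.degree < (0 : ℕ) := vanishBelow_atInfty_iff.1 (by simpa using h)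
  simpa using this

/-- The polynomial part of a Laurent series in `1/z`. -/
theorem exists_polynomial_part (x : LaurentSeries ℝ) :
    ∃ q : ℝ[X], VanishBelow 1 (x - atInfty q) := by
  obtain ⟨d, hd⟩ : ∃ d : ℕ, VanishBelow (-d) x := by
    refine ⟨(-x.order).toNat, fun i hi => HahnSeries.coeff_eq_zero_of_lt_order ?_⟩
    omega
  refine ⟨∑ k ∈ Finset.range (d + 1), monomial k (x.coeff (-k)), fun i hi => ?_⟩
  rw [HahnSeries.coeff_sub, coeff_atInfty, if_pos (by omega), finsetSum_coeff]
  simp only [coeff_monomial]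
  rw [Finset.sum_ite_eq']
  split_ifs with h
  · rw [sub_eq_zero]
    congr 1
    omega
  · rw [sub_zero]
    exact hd i (by simp at h; omega)

/-! ### Hankel determinants as approximation conditions on the moment series. -/

/-- The formal series `-∑ s_i / z^(i+1)`. -/
noncomputable def momentSeries (s : ℕ → ℝ) : LaurentSeries ℝ :=
  -(HahnSeries.single 1 1 * HahnSeries.ofPowerSeries ℤ ℝ (PowerSeries.mk s))

theorem coeff_momentSeries (s : ℕ → ℝ) (i : ℕ) : (momentSeries s).coeff (i + 1) = -s i := by
  rw [momentSeries, HahnSeries.coeff_neg, HahnSeries.coeff_single_mul, add_sub_cancel_right,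
    LaurentSeries.coeff_coe_powerSeries]
  simp

theorem vanishBelow_momentSeries (s : ℕ → ℝ) : VanishBelow 1 (momentSeries s) := by
  rw [momentSeries]
  simpa using ((vanishBelow_single (1 : ℝ)).mul (vanishBelow_ofPowerSeries (.mk s))).neg

theorem coeff_momentSeries_mul_atInfty (s : ℕ → ℝ) {p : ℝ[X]} {n : ℕ} (hp : p.degree < n)
    (i : ℕ) : (momentSeries s * atInfty p).coeff (i + 1) =
      -∑ j : Fin n, s (i + j) * p.coeff j := by
  have hp' : p = ∑ j ∈ Finset.range n, monomial j (p.coeff j) := by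
    ext k
    simp only [finsetSum_coeff, coeff_monomial]
    rw [Finset.sum_ite_eq']
    split_ifs with h
    · rfl
    · exact (degree_lt_iff_coeff_zero p n).1 hp k (by simpa using h)
  conv_lhs => rw [hp']
  rw [map_sum, Finset.mul_sum, HahnSeries.coeff_sum, ← Finset.sum_neg_distrib,
    Finset.sum_range]
  refine Finset.sum_congr rfl fun j _ => ?_
  rw [atInfty_monomial, HahnSeries.coeff_mul_single]
  have : (i + 1 - -(j : ℤ) : ℤ) = ((i + j : ℕ) : ℤ) + 1 := by push_cast; ring
  rw [this, coeff_momentSeries]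
  ring

/-- If `v` is the coefficient vector of `p`, the coefficients of `f p` at `z^(-1), …, z^(-n)` are
the entries of `-S_n v`; `q` absorbs the polynomial part. -/
theorem det_hankel_eq_zero_iff {s : ℕ → ℝ} {n : ℕ} :
    (hankel s n).det = 0 ↔ ∃ p : ℝ[X], p ≠ 0 ∧ p.degree < n ∧ ∃ q : ℝ[X],
      VanishBelow (n + 1) (momentSeries s * atInfty p - atInfty q) := by
  rw [← Matrix.exists_mulVec_eq_zero_iff]
  constructor
  · rintro ⟨v, hv, hSv⟩
    have hcoeff : ∀ j : Fin n, (degreeLTEquiv ℝ n |>.symm v : ℝ[X]).coeff j = v j := fun j =>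
      congrFun ((degreeLTEquiv ℝ n).apply_symm_apply v) j
    set p := ((degreeLTEquiv ℝ n).symm v : ℝ[X]) with hp
    have hdeg : p.degree < n := mem_degreeLT.1 ((degreeLTEquiv ℝ n).symm v).2
    obtain ⟨q, hq⟩ := exists_polynomial_part (momentSeries s * atInfty p)
    refine ⟨p, ?_, hdeg, q, fun i hi => ?_⟩
    · intro h0
      apply hv
      ext j
      rw [← hcoeff, h0]
      simp
    · rcases lt_or_ge i 1 with h1 | h1
      · exact hq i h1
      · obtain ⟨k, rfl⟩ : ∃ k : ℕ, i = k + 1 := ⟨(i - 1).toNat, by omega⟩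
        rw [HahnSeries.coeff_sub, coeff_momentSeries_mul_atInfty s hdeg, coeff_atInfty,
          if_neg (by omega), sub_zero, neg_eq_zero]
        have := congrFun hSv ⟨k, by omega⟩
        simpa [Matrix.mulVec, dotProduct, hankel, hcoeff] using this
  · rintro ⟨p, hp0, hdeg, q, hq⟩
    refine ⟨fun j => p.coeff j, ?_, ?_⟩
    · intro h
      apply hp0
      ext k
      rcases lt_or_ge k n with hk | hk
      · simpa using congrFun h ⟨k, hk⟩
      · simpa using (degree_lt_iff_coeff_zero p n).1 hdeg k hk
    · ext i
      have := hq (i + 1) (by have := i.2; omega)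
      rw [HahnSeries.coeff_sub, coeff_momentSeries_mul_atInfty s hdeg, coeff_atInfty,
        if_neg (by omega), sub_zero, neg_eq_zero] at this
      simpa [Matrix.mulVec, dotProduct, hankel] using this

theorem momentSeries_mul_atInfty_X (s : ℕ → ℝ) :
    momentSeries s * atInfty X = momentSeries (shift s) - atInfty (C (s 0)) := by
  have h : HahnSeries.ofPowerSeries ℤ ℝ (PowerSeries.mk s) = HahnSeries.C (s 0) +
      HahnSeries.single 1 1 * HahnSeries.ofPowerSeries ℤ ℝ (PowerSeries.mk (shift s)) := by
    rw [← HahnSeries.ofPowerSeries_C, ← HahnSeries.ofPowerSeries_X, ← map_mul, ← map_add]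
    congr 1
    ext n
    cases n <;> simp [shift, PowerSeries.coeff_succ_X_mul]
  have hzw : (HahnSeries.single (1 : ℤ) (1 : ℝ)) * HahnSeries.single (-1) 1 = 1 := by
    simp [HahnSeries.single_mul_single]
  rw [atInfty_X, atInfty_C, momentSeries, momentSeries, h]
  linear_combination (-(HahnSeries.C (s 0) +
      HahnSeries.single 1 1 * HahnSeries.ofPowerSeries ℤ ℝ (PowerSeries.mk (shift s)))) * hzw

/-- The series of the shifted sequence is `z f + s_0`, and `s_0 p` is absorbed into `q`. -/
theorem det_hankel_shift_eq_zero_iff {s : ℕ → ℝ} {n : ℕ} :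
    (hankel (shift s) n).det = 0 ↔ ∃ p : ℝ[X], p ≠ 0 ∧ p.degree < n ∧ ∃ q : ℝ[X],
      VanishBelow (n + 1) (momentSeries s * atInfty (X * p) - atInfty q) := by
  rw [det_hankel_eq_zero_iff]
  refine exists_congr fun p => and_congr_right fun _ => and_congr_right fun _ =>
    ⟨fun ⟨q, hq⟩ => ⟨q - C (s 0) * p, ?_⟩, fun ⟨q, hq⟩ => ⟨q + C (s 0) * p, ?_⟩⟩
  · convert hq using 1
    simp only [map_mul, map_sub]
    linear_combination atInfty p * momentSeries_mul_atInfty_X s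
  · convert hq using 1
    simp only [map_mul, map_add]
    linear_combination -atInfty p * momentSeries_mul_atInfty_X s

/-! ### One Schur step as identities between Laurent series. -/

theorem one_le_firstIndex (s : ℕ → ℝ) : 1 ≤ firstIndex s := Nat.le_add_left 1 _

theorem apply_firstIndex_sub_one_ne_zero {s : ℕ → ℝ} (hs : s ≠ 0) : s (firstIndex s - 1) ≠ 0 :=
  Nat.sInf_mem (s := {i | s i ≠ 0}) (Function.ne_iff.1 hs)

theorem eq_zero_of_lt_firstIndex_sub_one {s : ℕ → ℝ} {i : ℕ} (hi : i < firstIndex s - 1) :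
    s i = 0 := by
  by_contra h
  exact Nat.notMem_of_lt_sInf (s := {i | s i ≠ 0}) hi h

theorem momentSeries_eq (s : ℕ → ℝ) :
    momentSeries s = -(HahnSeries.single (firstIndex s : ℤ) 1 * HahnSeries.ofPowerSeries ℤ ℝ
      (PowerSeries.mk fun i => s (firstIndex s - 1 + i))) := by
  rw [momentSeries, ← HahnSeries.ofPowerSeries_X, ← HahnSeries.ofPowerSeries_X_pow, ← map_mul,
    ← map_mul]
  congr 2
  have h : firstIndex s = firstIndex s - 1 + 1 := by have := one_le_firstIndex s; omega
  conv_rhs => rw [h, pow_succ', mul_assoc]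
  congr 1
  ext i
  rw [PowerSeries.coeff_X_pow_mul', PowerSeries.coeff_mk, PowerSeries.coeff_mk,
    Nat.add_sub_cancel]
  split_ifs with hi
  · congr 1; omega
  · exact eq_zero_of_lt_firstIndex_sub_one (not_le.1 hi)

theorem vanishBelow_momentSeries_firstIndex (s : ℕ → ℝ) :
    VanishBelow (firstIndex s) (momentSeries s) := by
  rw [momentSeries_eq]
  simpa using ((vanishBelow_single (1 : ℝ)).mul (vanishBelow_ofPowerSeries _)).neg

/-- The series `c_ν + c_{ν+1} / z + …` following the polynomial part of `-1/f`. -/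
noncomputable def schurTail (s : ℕ → ℝ) : LaurentSeries ℝ :=
  HahnSeries.ofPowerSeries ℤ ℝ
    (PowerSeries.mk fun r => PowerSeries.coeff (firstIndex s + r) (recipSeries s))

theorem coeff_schurM (s : ℕ → ℝ) (k : ℕ) : (schurM s).coeff k =
    if k < firstIndex s then PowerSeries.coeff (firstIndex s - 1 - k) (recipSeries s) else 0 := by
  rw [schurM, finsetSum_coeff]
  simp only [coeff_monomial]
  split_ifs with h
  · rw [Finset.sum_eq_single (firstIndex s - 1 - k)]
    · rw [if_pos (by omega)]
    · intro b hb hb'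
      rw [if_neg]
      rw [Finset.mem_range] at hb
      omega
    · intro h'
      rw [Finset.mem_range] at h'
      omega
  · refine Finset.sum_eq_zero fun i hi => if_neg ?_
    rw [Finset.mem_range] at hi
    omega

theorem atInfty_schurM_add_schurTail (s : ℕ → ℝ) :
    atInfty (X * schurM s) + schurTail s = HahnSeries.single (-(firstIndex s : ℤ)) 1 *
      HahnSeries.ofPowerSeries ℤ ℝ (recipSeries s) := by
  ext n
  rw [HahnSeries.coeff_single_mul, one_mul, HahnSeries.coeff_add, coeff_atInfty, schurTail,
    PowerSeries.coeff_coe, PowerSeries.coeff_coe, PowerSeries.coeff_mk]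
  have h1 := one_le_firstIndex s
  rcases lt_trichotomy n 0 with hn | rfl | hn
  · obtain ⟨k, hk⟩ : ∃ k : ℕ, (-n).toNat = k + 1 := ⟨(-n).toNat - 1, by omega⟩
    rw [if_pos hn.le, if_pos hn, add_zero, hk, coeff_X_mul, coeff_schurM]
    by_cases h : k < firstIndex s
    · rw [if_pos h, if_neg (by omega)]
      congr 2
      omega
    · rw [if_neg h, if_pos (by omega)]
  · rw [if_pos le_rfl, if_neg (lt_irrefl _), if_neg (by omega)]
    simp
  · rw [if_neg (by omega), if_neg (by omega), if_neg (by omega), zero_add]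
    congr 2
    omega

theorem constantCoeff_leading_ne_zero {s : ℕ → ℝ} (hs : s ≠ 0) :
    PowerSeries.constantCoeff (PowerSeries.mk fun i => s (firstIndex s - 1 + i)) ≠ 0 := by
  rw [← PowerSeries.coeff_zero_eq_constantCoeff_apply, PowerSeries.coeff_mk]
  exact apply_firstIndex_sub_one_ne_zero hs

theorem momentSeries_mul_schur {s : ℕ → ℝ} (hs : s ≠ 0) :
    momentSeries s * (atInfty (X * schurM s) + schurTail s) = -1 := by
  rw [atInfty_schurM_add_schurTail, momentSeries_eq, recipSeries]
  have h1 : HahnSeries.single (firstIndex s : ℤ) (1 : ℝ) *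
      HahnSeries.single (-(firstIndex s : ℤ)) 1 = 1 := by
    simp [HahnSeries.single_mul_single]
  have h2 := congrArg (HahnSeries.ofPowerSeries ℤ ℝ)
    (PowerSeries.mul_inv_cancel _ (constantCoeff_leading_ne_zero hs))
  rw [map_mul, map_one] at h2
  linear_combination (-HahnSeries.single (firstIndex s : ℤ) (1 : ℝ) *
      HahnSeries.single (-(firstIndex s : ℤ)) 1) * h2 - h1

theorem degree_X_mul_schurM {s : ℕ → ℝ} (hs : s ≠ 0) : 
    (X * schurM s).degree = (firstIndex s : WithBot ℕ) := by
  have h1 := one_le_firstIndex s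
  have h : (schurM s).coeff (firstIndex s - 1) ≠ 0 := by
    rw [coeff_schurM, if_pos (by omega), Nat.sub_self, PowerSeries.coeff_zero_eq_constantCoeff_apply,
      recipSeries, PowerSeries.constantCoeff_inv]
    exact inv_ne_zero (constantCoeff_leading_ne_zero hs)
  refine degree_eq_of_le_of_coeff_ne_zero ?_ ?_
  · rw [degree_le_iff_coeff_zero]
    intro m hm
    have hm' : firstIndex s < m := by exact_mod_cast hm
    obtain ⟨k, rfl⟩ : ∃ k, m = k + 1 := ⟨m - 1, by omega⟩
    rw [coeff_X_mul, coeff_schurM, if_neg (by omega)]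
  · obtain ⟨k, hk⟩ : ∃ k, firstIndex s = k + 1 := ⟨firstIndex s - 1, by omega⟩
    rw [hk, coeff_X_mul]
    simpa [hk] using h

/-- Nonzero sequence whose Schur step is defined: the constant term of `-1/f` does not vanish. -/
def SchurStep (s : ℕ → ℝ) : Prop :=
  s ≠ 0 ∧ PowerSeries.coeff (firstIndex s) (recipSeries s) ≠ 0

theorem schurTail_mul {s : ℕ → ℝ} (hs : SchurStep s) :
    schurTail s * (atInfty (C (schurL s)) + momentSeries (schurNext s)) = -1 := by
  set v : PowerSeries ℝ :=
    PowerSeries.mk fun r => PowerSeries.coeff (firstIndex s + r) (recipSeries s) with hv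
  have hc : PowerSeries.constantCoeff v = PowerSeries.coeff (firstIndex s) (recipSeries s) := by
    rw [← PowerSeries.coeff_zero_eq_constantCoeff_apply, hv, PowerSeries.coeff_mk, add_zero]
  have h0 : PowerSeries.constantCoeff v ≠ 0 := hc ▸ hs.2
  have hinv : v⁻¹ = PowerSeries.C (-schurL s) + PowerSeries.X * PowerSeries.mk (schurNext s) := by
    ext n
    cases n with
    | zero => simp [hc, schurL, div_eq_mul_inv]
    | succ n => simp [PowerSeries.coeff_succ_X_mul, schurNext, ← hv]
  have h := congrArg (HahnSeries.ofPowerSeries ℤ ℝ) (PowerSeries.mul_inv_cancel v h0)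
  rw [hinv, map_mul, map_add, map_mul, map_one, HahnSeries.ofPowerSeries_C,
    HahnSeries.ofPowerSeries_X, map_neg] at h
  rw [atInfty_C, schurTail, momentSeries, ← hv]
  linear_combination -h

theorem schurL_ne_zero {s : ℕ → ℝ} (hs : SchurStep s) : schurL s ≠ 0 :=
  div_ne_zero (by norm_num) hs.2

/-- The residual `f P - Q` under a Schur step. -/
theorem residual_schurNext {s : ℕ → ℝ} (hs : SchurStep s) (P Q : ℝ[X]) :
    momentSeries s * atInfty (P - X * schurM s * (Q + C (schurL s) * P)) -
        atInfty (Q + C (schurL s) * P) =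
      -(momentSeries s * schurTail s *
        (momentSeries (schurNext s) * atInfty P - atInfty Q)) := by
  have h1 := momentSeries_mul_schur hs.1
  have h2 := schurTail_mul hs
  rw [map_sub, map_mul atInfty (X * schurM s), map_add, map_mul _ (C _)]
  linear_combination (-(atInfty Q + atInfty (C (schurL s)) * atInfty P)) * h1 +
    momentSeries s * atInfty P * h2

theorem vanishBelow_residual_schurNext {s : ℕ → ℝ} (hs : SchurStep s) {P Q : ℝ[X]} {k : ℤ}
    (h : VanishBelow k (momentSeries (schurNext s) * atInfty P - atInfty Q)) :
    VanishBelow (k + firstIndex s) (momentSeries s *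
      atInfty (P - X * schurM s * (Q + C (schurL s) * P)) - atInfty (Q + C (schurL s) * P)) := by
  rw [residual_schurNext hs]
  have hV : VanishBelow 0 (schurTail s) := vanishBelow_ofPowerSeries _
  exact (((vanishBelow_momentSeries_firstIndex s).mul hV).mul h).neg.mono (by omega)

/-! ### Normal indices and regularity under a Schur step. -/

/-- `det S_n⁺ ≠ 0` for every normal index `n`. -/
def RegularSeq (s : ℕ → ℝ) : Prop := ∀ n ∈ normalIndices s, (hankel (shift s) n).det ≠ 0

theorem det_hankel_eq_zero_of_lt_firstIndex {s : ℕ → ℝ} {n : ℕ} (hn : 1 ≤ n)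
    (hlt : n < firstIndex s) : (hankel s n).det = 0 := by
  rw [det_hankel_eq_zero_iff]
  refine ⟨1, one_ne_zero, ?_, 0, ?_⟩
  · rw [degree_one]; exact_mod_cast hn
  · simp only [map_one, mul_one, map_zero, sub_zero]
    exact (vanishBelow_momentSeries_firstIndex s).mono (by omega)

/-- For `deg p < ν` the product `f p` is already `O(1/z)`, so `q = 0`; multiplying `f p =
O(z^(-ν-1))` by `1/f = O(z^ν)` leaves `p = O(1/z)`. -/
theorem det_hankel_firstIndex_ne_zero {s : ℕ → ℝ} (hs : s ≠ 0) :
    (hankel s (firstIndex s)).det ≠ 0 := by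
  intro h
  obtain ⟨p, hp0, hdeg, q, hq⟩ := det_hankel_eq_zero_iff.1 h
  have hF := vanishBelow_momentSeries_firstIndex s
  have hp := vanishBelow_atInfty_iff.2 hdeg
  have hq0 : q = 0 := by
    apply eq_zero_of_vanishBelow_one
    have := ((hF.mul hp).mono (k := 1) (by omega)).sub (hq.mono (k := 1) (by omega))
    simpa using this
  rw [hq0, map_zero, sub_zero] at hq
  have hI : VanishBelow (-(firstIndex s : ℤ)) (atInfty (X * schurM s) + schurTail s) := by
    rw [atInfty_schurM_add_schurTail]
    simpa using (vanishBelow_single (1 : ℝ)).mul (vanishBelow_ofPowerSeries (recipSeries s))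
  apply hp0
  apply eq_zero_of_vanishBelow_one
  have : atInfty p = -((atInfty (X * schurM s) + schurTail s) * (momentSeries s * atInfty p)) := by
    linear_combination atInfty p * momentSeries_mul_schur hs
  rw [this]
  exact ((hI.mul hq).mono (by omega)).neg

/-- If `c_ν = 0`, the tail of `-1/f` is `O(1/z)`, so `f z m + 1 = O(z^(-ν-1))` and `m` is a null
vector of `S_ν⁺`, although `ν` is normal. -/
theorem RegularSeq.schurStep {s : ℕ → ℝ} (hr : RegularSeq s) (hs : s ≠ 0) : SchurStep s := by
  refine ⟨hs, fun hc => ?_⟩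
  refine hr _ ⟨one_le_firstIndex s, det_hankel_firstIndex_ne_zero hs⟩ ?_
  have hd := degree_X_mul_schurM hs
  rw [det_hankel_shift_eq_zero_iff]
  refine ⟨schurM s, ?_, ?_, -1, ?_⟩
  · rintro h0
    rw [h0, mul_zero, degree_zero] at hd
    exact absurd hd (by simp)
  · rw [degree_lt_iff_coeff_zero]
    intro m hm
    rw [coeff_schurM, if_neg (by omega)]
  · have hV : VanishBelow 1 (schurTail s) := by
      intro i hi
      rw [schurTail, PowerSeries.coeff_coe]
      split_ifs with h
      · rfl
      · obtain rfl : i = 0 := by omega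
        simpa using hc
    have : momentSeries s * atInfty (X * schurM s) - atInfty (-1) =
        -(momentSeries s * schurTail s) := by
      rw [map_neg, map_one]
      linear_combination momentSeries_mul_schur hs
    rw [this]
    exact ((vanishBelow_momentSeries_firstIndex s).mul hV).neg

theorem step_ne_zero {s : ℕ → ℝ} (hs : SchurStep s) {P Q : ℝ[X]} (hP : P ≠ 0) {k : ℤ}
    (hk : 1 ≤ k) (h : VanishBelow k (momentSeries (schurNext s) * atInfty P - atInfty Q)) :
    P - X * schurM s * (Q + C (schurL s) * P) ≠ 0 := by
  intro h0
  have h1 := vanishBelow_residual_schurNext hs h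
  rw [h0, map_zero, mul_zero, zero_sub] at h1
  have h2 : Q + C (schurL s) * P = 0 := by
    apply eq_zero_of_vanishBelow_one
    simpa using h1.neg.mono (k := 1) (by omega)
  rw [h2, mul_zero, sub_zero] at h0
  exact hP h0

theorem degree_lt_of_residual {s : ℕ → ℝ} {P Q : ℝ[X]} {n : ℕ} (hP : P.degree < n)
    {k : ℤ} (hk : 1 - n ≤ k) (h : VanishBelow k (momentSeries s * atInfty P - atInfty Q)) :
    Q.degree < n := by
  rw [← vanishBelow_atInfty_iff] at *
  have := (((vanishBelow_momentSeries s).mul hP).mono (k := 1 - n) (by omega)).sub (h.mono hk)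
  simpa using this

theorem degree_step_lt {s : ℕ → ℝ} (hs : SchurStep s) {P Q : ℝ[X]} {n : ℕ} (hP : P.degree < n)
    (hQ : Q.degree < n) : (P - X * schurM s * (Q + C (schurL s) * P)).degree <
      ((n + firstIndex s : ℕ) : WithBot ℕ) := by
  rw [← vanishBelow_atInfty_iff] at *
  have hM : VanishBelow (1 - (firstIndex s + 1 : ℕ)) (atInfty (X * schurM s)) := by
    rw [vanishBelow_atInfty_iff, degree_X_mul_schurM hs.1]
    exact_mod_cast Nat.lt_succ_self _
  have hC : VanishBelow (1 - (1 : ℕ)) (atInfty (C (schurL s))) :=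
    vanishBelow_atInfty_iff.2 (by exact_mod_cast degree_C_lt)
  rw [map_sub, map_mul _ (X * schurM s), map_add, map_mul _ (C _)]
  refine (hP.mono (by omega)).sub ((hM.mul (hQ.add ((hC.mul hP).mono ?_))).mono ?_) <;>
  · push_cast; omega

/-- A Schur step is invertible on pairs: `(p, q)` comes from `P = p + z m q`, `Q = q - l P`. Both
directions carry a degeneracy witness along. -/
theorem det_hankel_add_firstIndex_eq_zero_iff {s : ℕ → ℝ} (hs : SchurStep s) (n : ℕ) :
    (hankel s (n + firstIndex s)).det = 0 ↔ (hankel (schurNext s) n).det = 0 := by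
  have h1 := one_le_firstIndex s
  rw [det_hankel_eq_zero_iff, det_hankel_eq_zero_iff]
  constructor
  · rintro ⟨p, hp0, hdeg, q, hq⟩
    have hF := vanishBelow_momentSeries_firstIndex s
    have hp := vanishBelow_atInfty_iff.2 hdeg
    have hI : VanishBelow (-(firstIndex s : ℤ)) (atInfty (X * schurM s) + schurTail s) := by
      rw [atInfty_schurM_add_schurTail]
      simpa using (vanishBelow_single (1 : ℝ)).mul (vanishBelow_ofPowerSeries (recipSeries s))
    have hqv : VanishBelow (1 - n) (atInfty q) := by
      have := ((hF.mul hp).mono (k := 1 - n) (by push_cast; omega)).sub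
        (hq.mono (k := 1 - n) (by push_cast; omega))
      simpa using this
    have hF1 := momentSeries_mul_schur hs.1
    have hV := schurTail_mul hs
    have hVO : VanishBelow 0 (schurTail s) := vanishBelow_ofPowerSeries _
    have hp'v : VanishBelow (1 - n) (atInfty (p + X * schurM s * q)) := by
      -- The summands may have degree up to `n + ν - 1`; substituting `f (z m + V) = -1`, with `V`
      -- the tail, exhibits their cancellation.
      have : atInfty (p + X * schurM s * q) = -(schurTail s * atInfty q) -
          (atInfty (X * schurM s) + schurTail s) *
            (momentSeries s * atInfty p - atInfty q) := by
        rw [map_add, map_mul _ (X * schurM s)]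
        linear_combination (atInfty p) * hF1
      rw [this]
      exact ((hVO.mul hqv).neg.mono (by omega)).sub ((hI.mul hq).mono (by push_cast; omega))
    have hres : VanishBelow (n + 1) (momentSeries (schurNext s) * atInfty (p + X * schurM s * q) -
        atInfty (q - C (schurL s) * (p + X * schurM s * q))) := by
      have h := residual_schurNext hs (p + X * schurM s * q)
        (q - C (schurL s) * (p + X * schurM s * q))
      rw [sub_add_cancel, add_sub_cancel_right] at h
      set R := momentSeries (schurNext s) * atInfty (p + X * schurM s * q) -
        atInfty (q - C (schurL s) * (p + X * schurM s * q))
      -- The step multiplies residuals by `-f V`, whose inverse is `-(l + f₁)(z m + V)`, of growth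
      -- at most `z^ν`.
      have : R = -((atInfty (C (schurL s)) + momentSeries (schurNext s)) *
          ((atInfty (X * schurM s) + schurTail s) *
            (momentSeries s * atInfty p - atInfty q))) := by
        rw [h]
        linear_combination (-schurTail s * (atInfty (C (schurL s)) +
          momentSeries (schurNext s)) * R) * hF1 + R * hV
      rw [this]
      have hC : VanishBelow (1 - (1 : ℕ)) (atInfty (C (schurL s))) :=
        vanishBelow_atInfty_iff.2 (by exact_mod_cast degree_C_lt)
      refine (((hC.add ((vanishBelow_momentSeries _).mono (by omega))).mul
        (hI.mul hq)).mono ?_).neg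
      push_cast; omega
    refine ⟨_, fun h0 => ?_, vanishBelow_atInfty_iff.1 hp'v, _, hres⟩
    rw [h0, map_zero, mul_zero, mul_zero, sub_zero, zero_sub] at hres
    have hq0 : q = 0 := by
      apply eq_zero_of_vanishBelow_one
      simpa using hres.neg.mono (k := 1) (by omega)
    rw [hq0, mul_zero, add_zero] at h0
    exact hp0 h0
  · rintro ⟨p, hp0, hdeg, q, hq⟩
    exact ⟨_, step_ne_zero hs hp0 (by omega) hq,
      degree_step_lt hs hdeg (degree_lt_of_residual hdeg (by omega) hq), _,
      (vanishBelow_residual_schurNext hs hq).mono (by push_cast; omega)⟩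

/-- A Schur step preserves divisibility of the denominator by `z`, so a null vector of the induced
shifted Hankel matrix lifts to one for `s`. -/
theorem RegularSeq.schurNext {s : ℕ → ℝ} (hr : RegularSeq s) (hs : s ≠ 0) :
    RegularSeq (schurNext s) := by
  rintro n ⟨hn, hdet⟩ h0
  have hst := hr.schurStep hs
  obtain ⟨p, hp0, hdeg, q, hq⟩ := det_hankel_shift_eq_zero_iff.1 h0
  refine hr (n + firstIndex s) ⟨by omega, mt (det_hankel_add_firstIndex_eq_zero_iff hst n).1 hdet⟩ ?_
  have hXp : (X * p).degree < ((n + 1 : ℕ) : WithBot ℕ) := by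
    rw [degree_lt_iff_coeff_zero] at *
    intro m hm
    obtain ⟨k, rfl⟩ : ∃ k, m = k + 1 := ⟨m - 1, by omega⟩
    rw [coeff_X_mul]
    exact hdeg k (by omega)
  have hqd := degree_lt_of_residual hXp (by omega) hq
  have hne := step_ne_zero hst (mul_ne_zero X_ne_zero hp0) (by omega) hq
  have hd := degree_step_lt hst hXp hqd
  have hv := vanishBelow_residual_schurNext hst hq
  have hfac : X * p - X * schurM s * (q + C (schurL s) * (X * p)) =
      X * (p - schurM s * (q + C (schurL s) * (X * p))) := by ring
  rw [hfac] at hne hd hv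
  rw [det_hankel_shift_eq_zero_iff]
  refine ⟨_, right_ne_zero_of_mul hne, ?_, _, hv.mono (by push_cast; omega)⟩
  rw [degree_lt_iff_coeff_zero] at *
  intro m hm
  rw [← coeff_X_mul]
  exact hd _ (by omega)

/-! ### Approximants at normal indices. -/

/-- `Q/P` with `deg Q < deg P = n` approximates `-∑ s_i / z^(i+1)`, with `f P - Q = O(z^(-k))`. -/
structure Approximant (s : ℕ → ℝ) (n : ℕ) (k : ℤ) (P Q : ℝ[X]) : Prop where
  degree_eq : P.degree = (n : WithBot ℕ)
  degree_lt : Q.degree < (n : WithBot ℕ)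
  vanish : VanishBelow k (momentSeries s * atInfty P - atInfty Q)

/-- Since `l ≠ 0`, `Q + l P` has degree exactly `n`, and the product with `z m` dominates the new
denominator. -/
theorem Approximant.schurStep {s : ℕ → ℝ} (hs : SchurStep s) {n : ℕ} {k : ℤ} {P Q : ℝ[X]}
    (h : Approximant (schurNext s) n k P Q) :
    Approximant s (n + firstIndex s) (k + firstIndex s)
      (P - X * schurM s * (Q + C (schurL s) * P)) (Q + C (schurL s) * P) := by
  have h1 := one_le_firstIndex s
  have hlP : (C (schurL s) * P).degree = (n : WithBot ℕ) := by
    rw [degree_C_mul (schurL_ne_zero hs), h.degree_eq]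
  have hQ : (Q + C (schurL s) * P).degree = (n : WithBot ℕ) := by
    rw [degree_add_eq_right_of_degree_lt, hlP]
    rw [hlP]
    exact h.degree_lt
  have hMQ : (X * schurM s * (Q + C (schurL s) * P)).degree =
      ((n + firstIndex s : ℕ) : WithBot ℕ) := by
    rw [degree_mul, degree_X_mul_schurM hs.1, hQ, Nat.cast_add, add_comm]
  refine ⟨?_, ?_, vanishBelow_residual_schurNext hs h.vanish⟩
  · rw [degree_sub_eq_right_of_degree_lt, hMQ]
    rw [hMQ, h.degree_eq]
    exact_mod_cast (by omega : n < n + firstIndex s)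
  · rw [hQ]
    exact_mod_cast (by omega : n < n + firstIndex s)

theorem ne_zero_of_det_hankel_ne_zero {s : ℕ → ℝ} {n : ℕ} (hn : 1 ≤ n)
    (h : (hankel s n).det ≠ 0) : s ≠ 0 := by
  rintro rfl
  apply h
  exact Matrix.det_eq_zero_of_row_eq_zero ⟨0, hn⟩ fun j => by simp [hankel]

theorem firstIndex_le_of_det_hankel_ne_zero {s : ℕ → ℝ} {n : ℕ} (hn : 1 ≤ n)
    (h : (hankel s n).det ≠ 0) : firstIndex s ≤ n :=
  not_lt.1 fun hlt => h (det_hankel_eq_zero_of_lt_firstIndex hn hlt)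

/-- Schur steps descend to `n = 0`, where `P = 1`, `Q = 0` works; each step back preserves `k - n =
1`. -/
theorem exists_approximant {s : ℕ → ℝ} (hr : RegularSeq s) {n : ℕ} (hn : (hankel s n).det ≠ 0) :
    ∃ P Q, Approximant s n (n + 1) P Q := by
  induction n using Nat.strong_induction_on generalizing s with
  | _ n ih =>
  rcases Nat.eq_zero_or_pos n with rfl | hpos
  · refine ⟨1, 0, by simp, by simp, ?_⟩
    simpa using vanishBelow_momentSeries s
  · have hs := ne_zero_of_det_hankel_ne_zero hpos hn
    obtain ⟨m, rfl⟩ := Nat.exists_eq_add_of_le' (firstIndex_le_of_det_hankel_ne_zero hpos hn)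
    have h1 := one_le_firstIndex s
    have hst := hr.schurStep hs
    obtain ⟨P, Q, h⟩ := ih m (by omega) (hr.schurNext hs)
      (mt (det_hankel_add_firstIndex_eq_zero_iff hst m).2 hn)
    have h2 := h.schurStep hst
    rw [add_right_comm, ← Nat.cast_add] at h2
    exact ⟨_, _, h2⟩

theorem approximant_schurM {s : ℕ → ℝ} (hs : s ≠ 0) :
    Approximant s (firstIndex s) (firstIndex s) (-(X * schurM s)) 1 := by
  refine ⟨by rw [degree_neg, degree_X_mul_schurM hs], ?_, ?_⟩
  · rw [degree_one]
    exact_mod_cast one_le_firstIndex s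
  · have hV : VanishBelow 0 (schurTail s) := vanishBelow_ofPowerSeries _
    have : momentSeries s * atInfty (-(X * schurM s)) - atInfty 1 =
        momentSeries s * schurTail s := by
      rw [map_neg, map_one]
      linear_combination -momentSeries_mul_schur hs
    rw [this]
    simpa using (vanishBelow_momentSeries_firstIndex s).mul hV

/-- The descent stops at the first normal index, with the convergent `-1/(z m)`. It has one order
less, but its denominator vanishes at `0`, which later steps preserve. -/
theorem exists_approximant_eval_zero {s : ℕ → ℝ} (hr : RegularSeq s) {n : ℕ} (hpos : 1 ≤ n)
    (hn : (hankel s n).det ≠ 0) : ∃ P Q, Approximant s n n P Q ∧ P.eval 0 = 0 := by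
  induction n using Nat.strong_induction_on generalizing s with
  | _ n ih =>
  have hs := ne_zero_of_det_hankel_ne_zero hpos hn
  obtain ⟨m, rfl⟩ := Nat.exists_eq_add_of_le' (firstIndex_le_of_det_hankel_ne_zero hpos hn)
  rcases Nat.eq_zero_or_pos m with rfl | hm
  · rw [zero_add]
    exact ⟨_, _, approximant_schurM hs, by simp⟩
  · have h1 := one_le_firstIndex s
    have hst := hr.schurStep hs
    obtain ⟨P, Q, h, h0⟩ := ih m (by omega) (hr.schurNext hs) hm
      (mt (det_hankel_add_firstIndex_eq_zero_iff hst m).2 hn)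
    have h2 := h.schurStep hst
    rw [← Nat.cast_add] at h2
    exact ⟨_, _, h2, by simp [h0]⟩

/-! ### Composition of `N` steps and the enumeration of normal indices. -/

/-- The sum of the degrees of the first `N` polynomials `z m_i(z)`. -/
noncomputable def schurOffset (s : ℕ → ℝ) (N : ℕ) : ℕ :=
  ∑ i ∈ Finset.range N, firstIndex (induced s i)

theorem induced_succ (s : ℕ → ℝ) (N : ℕ) : induced s (N + 1) = schurNext (induced s N) :=
  Function.iterate_succ_apply' _ _ _

theorem schurOffset_succ (s : ℕ → ℝ) (N : ℕ) :
    schurOffset s (N + 1) = schurOffset s N + firstIndex (induced s N) :=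
  Finset.sum_range_succ _ _

theorem stieltjesSol_succ_combination (s : ℕ → ℝ) (y : ℝ[X] × ℝ[X]) (N : ℕ) (P Q : ℝ[X]) :
    (stieltjesSol s y (N + 1)).1 * Q + (stieltjesSol s y (N + 1)).2 * P =
      (stieltjesSol s y N).1 * (Q + C (schurL (induced s N)) * P) +
      (stieltjesSol s y N).2 * (P - X * schurM (induced s N) *
        (Q + C (schurL (induced s N)) * P)) := by
  simp only [stieltjesSol, mCoeff, lCoeff, Nat.add_sub_cancel]
  ring

/-- The resolvent matrix carries approximants of the induced sequence to approximants of `s`. -/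
theorem Approximant.resolvent {s : ℕ → ℝ} {N : ℕ} (hs : ∀ i < N, SchurStep (induced s i))
    {n : ℕ} {k : ℤ} {P Q : ℝ[X]} (h : Approximant (induced s N) n k P Q) :
    Approximant s (n + schurOffset s N) (k + schurOffset s N)
      ((stieltjesP s N).1 * Q + (stieltjesP s N).2 * P)
      ((stieltjesQ s N).1 * Q + (stieltjesQ s N).2 * P) := by
  induction N generalizing n k P Q with
  | zero => simpa [schurOffset, stieltjesP, stieltjesQ, stieltjesSol, induced] using h
  | succ N ih =>
    rw [induced_succ] at h
    have := ih (fun i hi => hs i (by omega)) (h.schurStep (hs N (by omega)))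
    rw [stieltjesP, stieltjesQ, stieltjesSol_succ_combination, stieltjesSol_succ_combination,
      schurOffset_succ]
    convert this using 1
    · omega
    · push_cast; ring
    · rfl
    · rfl

/-- Hence the transformed denominator takes the value `P(0)` at `0`. -/
theorem eval_zero_stieltjesP (s : ℕ → ℝ) (N : ℕ) :
    (stieltjesP s N).1.eval 0 = 0 ∧ (stieltjesP s N).2.eval 0 = 1 := by
  induction N with
  | zero => simp [stieltjesP, stieltjesSol]
  | succ N ih =>
    rw [stieltjesP] at ih
    simp [stieltjesP, stieltjesSol, ih.1, ih.2]

open Classical in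
theorem normal_schurOffset {s : ℕ → ℝ} (hr : RegularSeq s) {n j : ℕ} (hn : (hankel s n).det ≠ 0)
    (hj : Nat.count (fun n => (hankel s n).det ≠ 0) n = j) {N : ℕ} (hN : N ≤ j) :
    RegularSeq (induced s N) ∧ (∀ i < N, SchurStep (induced s i)) ∧
      (∀ m, (hankel s (schurOffset s N + m)).det = 0 ↔ (hankel (induced s N) m).det = 0) ∧
      Nat.count (fun n => (hankel s n).det ≠ 0) (schurOffset s N) = N := by
  induction N with
  | zero => exact ⟨hr, by simp, fun m => by
      rw [schurOffset, Finset.sum_range_zero, zero_add, induced, Function.iterate_zero, id],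
      by simp [schurOffset]⟩
  | succ N ih =>
    obtain ⟨ihr, ihs, ihm, ihc⟩ := ih (by omega)
    -- A normal index beyond the offset keeps the induced sequence nonzero, so a further step is
    -- possible.
    have hlt : schurOffset s N < n := by
      by_contra hle
      have := Nat.count_monotone (fun n => (hankel s n).det ≠ 0) (not_lt.1 hle)
      omega
    obtain ⟨m, rfl⟩ := Nat.exists_eq_add_of_lt hlt
    have hne : induced s N ≠ 0 := ne_zero_of_det_hankel_ne_zero (n := m + 1) (by omega)
      (mt (ihm _).2 hn)
    have hst := ihr.schurStep hne
    refine ⟨induced_succ s N ▸ ihr.schurNext hne, fun i hi => ?_, fun l => ?_, ?_⟩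
    · rcases Nat.lt_succ_iff_lt_or_eq.1 hi with h | rfl
      · exact ihs i h
      · exact hst
    · rw [schurOffset_succ, induced_succ, add_assoc, ihm, add_comm,
        det_hankel_add_firstIndex_eq_zero_iff hst]
    · rw [schurOffset_succ, Nat.count_add, ihc]
      congr 1
      -- In the block of `ν` indices starting at the offset only the first is counted: it
      -- corresponds to the empty determinant of the induced sequence.
      obtain ⟨l, hl⟩ := Nat.exists_eq_add_of_le' (one_le_firstIndex (induced s N))
      rw [hl, Nat.count_succ', if_pos, Nat.count_of_forall_not]
      · intro i hi
        simp only [ne_eq, not_not]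
        rw [ihm]
        exact det_hankel_eq_zero_of_lt_firstIndex (by omega) (by omega)
      · simp only [ne_eq, ihm]
        simp

/-! ### Sectorial asymptotics and uniqueness of Padé approximants. -/

/-- The filter of nontangential approach to infinity in a sector. -/
noncomputable def sectorFilter (ε : ℝ) : Filter ℂ :=
  Bornology.cobounded ℂ ⊓ 𝓟 {z : ℂ | ε < z.arg ∧ z.arg < Real.pi - ε}

theorem tendsto_eval_one_div (p : ℂ[X]) :
    Tendsto (fun z : ℂ => p.eval (1 / z)) (Bornology.cobounded ℂ) (nhds (p.eval 0)) := by
  simp only [one_div]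
  exact (p.continuous.tendsto 0).comp tendsto_inv₀_cobounded

/-- The positive imaginary axis lies in the sector. -/
theorem sectorFilter_neBot {ε : ℝ} (hε : ε < Real.pi / 2) : (sectorFilter ε).NeBot := by
  have h : Tendsto (fun t : ℝ => (t : ℂ) * Complex.I) atTop (sectorFilter ε) := by
    refine tendsto_inf.2 ⟨?_, tendsto_principal.2 ?_⟩
    · rw [← tendsto_norm_atTop_iff_cobounded]
      simpa using tendsto_abs_atTop_atTop
    · filter_upwards [eventually_gt_atTop 0] with t ht
      rw [Complex.arg_real_mul _ ht, Complex.arg_I]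
      constructor <;> linarith
  exact h.neBot

/-- With `w = 1/z`, write `G = w^k q`, `q(0) ≠ 0`, `k ≤ d`. The bound gives `q(1/z) = O(1/z)`, hence
`q(0) = 0`, a contradiction. -/
theorem eq_zero_of_isBigO_one_div_pow {l : Filter ℂ} [l.NeBot] (hl : l ≤ Bornology.cobounded ℂ)
    {G : ℂ[X]} {d : ℕ} (hd : G.natDegree ≤ d)
    (hG : (fun z : ℂ => G.eval (1 / z)) =O[l] fun z : ℂ => 1 / z ^ (d + 1)) : G = 0 := by
  by_contra h0
  obtain ⟨q, hq, hndvd⟩ := exists_eq_pow_rootMultiplicity_mul_and_not_dvd G h0 0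
  set k := G.rootMultiplicity 0
  rw [dvd_iff_isRoot, IsRoot.def] at hndvd
  have hkd : k ≤ d := by
    have := natDegree_le_of_dvd (pow_rootMultiplicity_dvd G 0) h0
    rw [natDegree_pow, natDegree_X_sub_C, mul_one] at this
    exact this.trans hd
  have hne : ∀ᶠ z in l, z ≠ 0 := hl (Bornology.eventually_ne_cobounded 0)
  have h1 : (fun z : ℂ => q.eval (1 / z)) =O[l] fun z : ℂ => z⁻¹ := by
    refine IsBigO.trans (IsBigO.congr' (hG.mul (isBigO_refl (fun z : ℂ => z ^ k) l)) ?_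
      EventuallyEq.rfl) ?_
    · filter_upwards [hne] with z hz
      rw [hq]
      simp only [map_zero, sub_zero, eval_mul, eval_pow, eval_X]
      rw [mul_right_comm, ← mul_pow, one_div_mul_cancel hz, one_pow, one_mul]
    · refine IsBigO.of_bound 1 ?_
      have hnorm : ∀ᶠ z : ℂ in l, 1 ≤ ‖z‖ :=
        hl (tendsto_norm_cobounded_atTop.eventually_ge_atTop 1)
      filter_upwards [hne, hnorm] with z hz hz1
      have hz0 : 0 < ‖z‖ := norm_pos_iff.2 hz
      rw [one_mul, norm_mul, norm_div, norm_one, norm_pow, norm_pow, norm_inv, one_div_mul_eq_div,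
        div_le_iff₀ (by positivity), pow_succ', inv_mul_cancel_left₀ hz0.ne']
      exact pow_le_pow_right₀ hz1 hkd
  have h2 : Tendsto (fun z : ℂ => q.eval (1 / z)) l (nhds 0) :=
    h1.trans_tendsto (tendsto_inv₀_cobounded.mono_left hl)
  exact hndvd (tendsto_nhds_unique ((tendsto_eval_one_div q).mono_left hl) h2)

theorem aeval_inv_X_reflect {p : ℂ[X]} {n : ℕ} (hp : p.natDegree ≤ n) :
    aeval (RatFunc.X⁻¹ : RatFunc ℂ) (reflect n p) * RatFunc.X ^ n =
      algebraMap ℂ[X] (RatFunc ℂ) p := by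
  have hX : (RatFunc.X : RatFunc ℂ) ≠ 0 := RatFunc.X_ne_zero
  let _ := invertibleOfNonzero hX
  have h := eval₂_reflect_mul_pow (algebraMap ℂ (RatFunc ℂ)) RatFunc.X n p hp
  rw [invOf_eq_inv] at h
  rw [aeval_def, h, ← aeval_def, ← RatFunc.algebraMap_X, aeval_algebraMap_apply, aeval_X_left_apply]

theorem aeval_inv_X_ne_zero {p : ℂ[X]} (hp : p ≠ 0) :
    aeval (RatFunc.X⁻¹ : RatFunc ℂ) p ≠ 0 := by
  intro h
  have h1 := aeval_inv_X_reflect (p := reflect p.natDegree p) (n := p.natDegree)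
    (by simpa using natDegree_reflect_le (p := p) (N := p.natDegree))
  rw [reflect_reflect, h, zero_mul] at h1
  have h2 := (map_eq_zero_iff _ (RatFunc.algebraMap_injective ℂ)).1 h1.symm
  exact hp (reflect_eq_zero_iff.1 h2)

/-- `A B' - A' B` has degree at most `L + M` in `1/z` but is `O(z^(-(L+M+1)))` in a sector. -/
theorem IsPade.unique {s : ℕ → ℝ} {L M : ℕ} {R R' : RatFunc ℂ} (h : IsPade s L M R)
    (h' : IsPade s L M R') : R = R' := by
  obtain ⟨A, B, hA, hB, hB0, rfl, hO⟩ := h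
  obtain ⟨A', B', hA', hB', hB0', rfl, hO'⟩ := h'
  have hpi := Real.pi_pos
  have hε : Real.pi / 4 < Real.pi / 2 := by linarith
  have hdiff := (hO _ (by positivity) hε).sub (hO' _ (by positivity) hε)
  change _ =O[sectorFilter (Real.pi / 4)] _ at hdiff
  have hl : sectorFilter (Real.pi / 4) ≤ Bornology.cobounded ℂ := inf_le_left
  have := sectorFilter_neBot hε
  have hb : ∀ p : ℂ[X], (fun z : ℂ => p.eval (1 / z)) =O[sectorFilter (Real.pi / 4)]
      (fun _ => (1 : ℂ)) := fun p => ((tendsto_eval_one_div p).mono_left hl).isBigO_one ℂ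
  have hG : A * B' - A' * B = 0 := by
    refine eq_zero_of_isBigO_one_div_pow (l := sectorFilter (Real.pi / 4)) hl (d := L + M) ?_ ?_
    · refine (natDegree_sub_le _ _).trans (max_le ?_ ?_)
      · exact natDegree_mul_le.trans (add_le_add hA hB')
      · exact natDegree_mul_le.trans (add_le_add hA' hB)
    · refine IsBigO.congr' (((hb B).mul (hb B')).mul hdiff) ?_ ?_
      · filter_upwards [((tendsto_eval_one_div B).mono_left hl).eventually_ne hB0,
          ((tendsto_eval_one_div B').mono_left hl).eventually_ne hB0'] with z hz hz'
        simp only [eval_sub, eval_mul]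
        field_simp
        ring
      · filter_upwards with z
        ring
  have hBne : B ≠ 0 := by rintro rfl; simp at hB0
  have hBne' : B' ≠ 0 := by rintro rfl; simp at hB0'
  rw [div_eq_div_iff (aeval_inv_X_ne_zero hBne) (aeval_inv_X_ne_zero hBne'), ← map_mul, ← map_mul,
    sub_eq_zero.1 hG]

/-! ### From approximants to Padé approximants by reversing coefficients. -/

/-- Polynomials in `1/z` as Laurent series in `1/z`. -/
noncomputable def atZero : ℝ[X] →+* LaurentSeries ℝ :=
  (HahnSeries.ofPowerSeries ℤ ℝ).comp (coeToPowerSeries.ringHom (R := ℝ))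

theorem coeff_atZero (p : ℝ[X]) (i : ℤ) :
    (atZero p).coeff i = if i < 0 then 0 else p.coeff i.natAbs := by
  simp [atZero, PowerSeries.coeff_coe]

theorem X_pow_dvd_of_vanishBelow {p : ℝ[X]} {n : ℕ} (h : VanishBelow n (atZero p)) :
    X ^ n ∣ p := by
  rw [X_pow_dvd_iff]
  intro d hd
  simpa [coeff_atZero] using h d (by omega)

theorem atZero_reflect {p : ℝ[X]} {n : ℕ} (hp : p.natDegree ≤ n) :
    atZero (reflect n p) = HahnSeries.single (n : ℤ) 1 * atInfty p := by
  ext i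
  rw [coeff_atZero, HahnSeries.coeff_single_mul, one_mul, coeff_atInfty, coeff_reflect]
  split_ifs with h1 h2 h2
  · exact (coeff_eq_zero_of_natDegree_lt (by omega)).symm
  · rfl
  · rw [revAt_le (by omega)]
    congr 1
    omega
  · rw [revAt_eq_self_of_lt (by omega)]
    exact coeff_eq_zero_of_natDegree_lt (by omega)

/-- The truncated moment series as a polynomial in `1/z`. -/
noncomputable def momentPoly (s : ℕ → ℝ) (K : ℕ) : ℝ[X] :=
  ∑ j ∈ Finset.range K, monomial (j + 1) (s j)

theorem vanishBelow_momentSeries_add (s : ℕ → ℝ) (K : ℕ) :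
    VanishBelow (K + 1) (momentSeries s + atZero (momentPoly s K)) := by
  intro i hi
  rw [HahnSeries.coeff_add, coeff_atZero, momentPoly, finsetSum_coeff]
  simp only [coeff_monomial]
  rcases lt_or_ge i 1 with h | h
  · rw [vanishBelow_momentSeries s i h, zero_add]
    split_ifs
    · rfl
    · exact Finset.sum_eq_zero fun j _ => if_neg (by omega)
  · obtain ⟨m, rfl⟩ : ∃ m : ℕ, i = m + 1 := ⟨(i - 1).toNat, by omega⟩
    rw [coeff_momentSeries, if_neg (by omega), Finset.sum_eq_single m, if_pos (by omega),
      neg_add_cancel]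
    · exact fun j _ hj => if_neg (by omega)
    · intro hm
      rw [Finset.mem_range] at hm
      omega

theorem Approximant.natDegree_eq {s : ℕ → ℝ} {n : ℕ} {k : ℤ} {P Q : ℝ[X]}
    (h : Approximant s n k P Q) : P.natDegree = n := natDegree_eq_of_degree_eq_some h.degree_eq

theorem Approximant.ne_zero {s : ℕ → ℝ} {n : ℕ} {k : ℤ} {P Q : ℝ[X]}
    (h : Approximant s n k P Q) : P ≠ 0 := by
  rintro rfl
  exact absurd h.degree_eq (by simp)

theorem Approximant.natDegree_le {s : ℕ → ℝ} {n : ℕ} {k : ℤ} {P Q : ℝ[X]}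
    (h : Approximant s n k P Q) : Q.natDegree ≤ n := natDegree_le_of_degree_le h.degree_lt.le

/-- The right side is `-z^(-n) (f P - Q)` plus `z^(-n) P` times the truncation error of `f`, both of
sufficient order. Divisibility lets the formal estimate be evaluated at complex points. -/
theorem Approximant.X_pow_dvd {s : ℕ → ℝ} {n M : ℕ} {k : ℤ} {P Q : ℝ[X]}
    (h : Approximant s n k P Q) (hk : M + 1 ≤ k) :
    X ^ (n + M + 1) ∣ reflect n Q + reflect n P * momentPoly s (n + M + 1) := by
  apply X_pow_dvd_of_vanishBelow
  rw [map_add, map_mul, atZero_reflect h.natDegree_le, atZero_reflect h.natDegree_eq.le]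
  have hP : VanishBelow (1 - (n + 1 : ℕ)) (atInfty P) := by
    rw [vanishBelow_atInfty_iff, h.degree_eq]
    exact_mod_cast Nat.lt_succ_self n
  have hw : VanishBelow n (HahnSeries.single (n : ℤ) (1 : ℝ)) := vanishBelow_single 1
  have h1 := (hw.mul h.vanish).neg.mono (k := (n + M + 1 : ℕ)) (by push_cast; omega)
  have h2 := (hw.mul (hP.mul (vanishBelow_momentSeries_add s (n + M + 1)))).mono
    (k := (n + M + 1 : ℕ)) (by push_cast; omega)
  convert h1.add h2 using 1
  ring

theorem toRat_add (p q : ℝ[X]) : toRat (p + q) = toRat p + toRat q := by simp [toRat]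

theorem toRat_mul (p q : ℝ[X]) : toRat (p * q) = toRat p * toRat q := by simp [toRat]

theorem toRat_ne_zero {p : ℝ[X]} (hp : p ≠ 0) : toRat p ≠ 0 := by
  rw [toRat, ne_eq, map_eq_zero_iff _ (RatFunc.algebraMap_injective ℂ),
    Polynomial.map_eq_zero_iff Complex.ofRealHom.injective]
  exact hp

theorem toRat_eq {p : ℝ[X]} {n : ℕ} (hp : p.natDegree ≤ n) :
    toRat p = aeval (RatFunc.X⁻¹ : RatFunc ℂ) ((reflect n p).map Complex.ofRealHom) *
      RatFunc.X ^ n := by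
  rw [← reflect_map, aeval_inv_X_reflect (natDegree_map_le.trans hp), toRat]

theorem Approximant.isPade {s : ℕ → ℝ} {n M : ℕ} {k : ℤ} {P Q : ℝ[X]}
    (h : Approximant s n k P Q) (hk : M + 1 ≤ k) (hM : (reflect n P).natDegree ≤ M) :
    IsPade s n M (toRat Q / toRat P) := by
  obtain ⟨E, hE⟩ := h.X_pow_dvd hk
  have hB0 : ((reflect n P).map Complex.ofRealHom).eval 0 ≠ 0 := by
    rw [← coeff_zero_eq_eval_zero, coeff_map, coeff_reflect, revAt_le n.zero_le, Nat.sub_zero,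
      ← h.natDegree_eq]
    simpa using h.ne_zero
  refine ⟨(reflect n Q).map Complex.ofRealHom, (reflect n P).map Complex.ofRealHom,
    natDegree_map_le.trans (natDegree_reflect_le.trans (max_le le_rfl h.natDegree_le)),
    natDegree_map_le.trans hM, hB0, ?_, fun ε _ _ => ?_⟩
  · rw [toRat_eq h.natDegree_le, toRat_eq h.natDegree_eq.le,
      mul_div_mul_right _ _ (pow_ne_zero _ RatFunc.X_ne_zero)]
  -- The estimate holds in a full neighbourhood of infinity, because `B(0)`, the leading coefficient
  -- of `P`, is nonzero.
  · refine IsBigO.mono ?_ (inf_le_left (a := Bornology.cobounded ℂ))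
    have hlim := (tendsto_eval_one_div (E.map Complex.ofRealHom)).div
      (tendsto_eval_one_div ((reflect n P).map Complex.ofRealHom)) hB0
    have hO := (hlim.isBigO_one ℂ).mul
      (isBigO_refl (fun z : ℂ => 1 / z ^ (n + M + 1)) (Bornology.cobounded ℂ))
    simp only [one_mul] at hO
    refine hO.congr' ?_ EventuallyEq.rfl
    filter_upwards [(tendsto_eval_one_div
      ((reflect n P).map Complex.ofRealHom)).eventually_ne hB0] with z hz
    have hz' := congrArg (fun p : ℝ[X] => (p.map Complex.ofRealHom).eval (1 / z)) hE
    have hsum : ((momentPoly s (n + M + 1)).map Complex.ofRealHom).eval (1 / z) =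
        ∑ j ∈ Finset.range (n + M + 1), (s j : ℂ) / z ^ (j + 1) := by
      rw [momentPoly, Polynomial.map_sum, eval_finsetSum]
      refine Finset.sum_congr rfl fun j _ => ?_
      simp [div_eq_mul_inv]
    simp only [Polynomial.map_add, Polynomial.map_mul, eval_add, eval_mul, hsum,
      Polynomial.map_pow, map_X, eval_pow, eval_X] at hz'
    rw [Pi.div_apply, div_mul_eq_mul_div, div_eq_iff hz, add_mul, div_mul_cancel₀ _ hz]
    rw [one_div_pow] at hz'
    linear_combination -hz'

theorem Approximant.natDegree_reflect_le {s : ℕ → ℝ} {n : ℕ} {k : ℤ} {P Q : ℝ[X]}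
    (h : Approximant s n k P Q) : (reflect n P).natDegree ≤ n :=
  Polynomial.natDegree_reflect_le.trans (max_le le_rfl h.natDegree_eq.le)

/-- `P(0)` is the coefficient of `z^(-n)` in the reversed denominator. -/
theorem Approximant.natDegree_reflect_le_sub_one {s : ℕ → ℝ} {n : ℕ} {k : ℤ} {P Q : ℝ[X]}
    (h : Approximant s n k P Q) (h0 : P.eval 0 = 0) : (reflect n P).natDegree ≤ n - 1 := by
  refine natDegree_le_pred h.natDegree_reflect_le ?_
  rw [coeff_reflect, revAt_le le_rfl, Nat.sub_self, coeff_zero_eq_eval_zero, h0]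

/-! ### The linear fractional transformation and the conclusion. -/

/-- The linear fractional transformation with the resolvent matrix, on quotients of polynomials. -/
theorem lft_resolventMatrix (s : ℕ → ℝ) (N : ℕ) {P Q : ℝ[X]} (hP : P ≠ 0)
    (hP' : (stieltjesP s N).1 * Q + (stieltjesP s N).2 * P ≠ 0) :
    lftDenom ((resolventMatrix s N).map toRat) (toRat Q / toRat P) ≠ 0 ∧
      toRat ((stieltjesQ s N).1 * Q + (stieltjesQ s N).2 * P) /
        toRat ((stieltjesP s N).1 * Q + (stieltjesP s N).2 * P) =
      lft ((resolventMatrix s N).map toRat) (toRat Q / toRat P) := by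
  have hP0 := toRat_ne_zero hP
  have hden : lftDenom ((resolventMatrix s N).map toRat) (toRat Q / toRat P) =
      toRat ((stieltjesP s N).1 * Q + (stieltjesP s N).2 * P) / toRat P := by
    simp only [lftDenom, resolventMatrix, Matrix.map_apply, Matrix.of_apply, Matrix.cons_val,
      toRat_add, toRat_mul]
    field_simp
  have hnum : ((resolventMatrix s N).map toRat) 0 0 * (toRat Q / toRat P) +
      ((resolventMatrix s N).map toRat) 0 1 =
      toRat ((stieltjesQ s N).1 * Q + (stieltjesQ s N).2 * P) / toRat P := by
    simp only [resolventMatrix, Matrix.map_apply, Matrix.of_apply, Matrix.cons_val,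
      toRat_add, toRat_mul]
    field_simp
  refine ⟨hden ▸ div_ne_zero (toRat_ne_zero hP') hP0, ?_⟩
  rw [lft, hnum, hden, div_div_div_cancel_right₀ hP0]

/-- An approximant of the induced sequence yields the Padé approximants of both sequences and
their relation. -/
theorem pade_transform {s : ℕ → ℝ} {N n M M' : ℕ} {k : ℤ} {P Q : ℝ[X]}
    (hs : ∀ i < N, SchurStep (induced s i)) (h : Approximant (induced s N) n k P Q)
    (hg : IsPade (induced s N) n M (toRat Q / toRat P))
    (hf : IsPade s (n + schurOffset s N) M'
      (toRat ((stieltjesQ s N).1 * Q + (stieltjesQ s N).2 * P) /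
        toRat ((stieltjesP s N).1 * Q + (stieltjesP s N).2 * P))) :
    (∃! f : RatFunc ℂ, IsPade s (n + schurOffset s N) M' f) ∧
      (∃! g : RatFunc ℂ, IsPade (induced s N) n M g) ∧
      ∀ f g : RatFunc ℂ, IsPade s (n + schurOffset s N) M' f → IsPade (induced s N) n M g →
        lftDenom ((resolventMatrix s N).map toRat) g ≠ 0 ∧
          f = lft ((resolventMatrix s N).map toRat) g := by
  refine ⟨⟨_, hf, fun _ h' => h'.unique hf⟩, ⟨_, hg, fun _ h' => h'.unique hg⟩, ?_⟩
  intro f g hf' hg'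
  rw [hf'.unique hf, hg'.unique hg]
  exact lft_resolventMatrix s N h.ne_zero (h.resolvent hs).ne_zero

/-- The set enumerated by `normalIndex` also contains `0`, which makes the inequality strict. -/
theorem lt_card_of_le_encard_normalIndices {s : ℕ → ℝ} {j : ℕ}
    (hj : (j : ℕ∞) ≤ (normalIndices s).encard)
    (hf : (Set.ofPred fun n => (hankel s n).det ≠ 0).Finite) : j < hf.toFinset.card := by
  have h0 : 0 ∈ hf.toFinset := by simp
  have hsub : normalIndices s ⊆ (hf.toFinset.erase 0 : Finset ℕ) := by
    rintro n ⟨hn, hdet⟩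
    have hn0 : n ≠ 0 := by omega
    simp [hn0, hdet]
  have h1 := hj.trans (Set.encard_le_encard hsub)
  rw [Set.encard_coe_eq_coe_finsetCard, Nat.cast_le, Finset.card_erase_of_mem h0] at h1
  have := Finset.card_pos.2 ⟨0, h0⟩
  omega

end IndefStieltjes

theorem mainTheorem9 (κ k : ℕ) (s : ℕ → ℝ) (hs : MemHReg κ k s)
    (N j : ℕ) (hN : 1 ≤ N) (hNj : N < j) (hj : (j : ℕ∞) ≤ (normalIndices s).encard) :
    ((∃! f : RatFunc ℂ, IsPade s (normalIndex s j) (normalIndex s j) f) ∧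
      (∃! g : RatFunc ℂ, IsPade (induced s N)
        (normalIndex s j - normalIndex s N) (normalIndex s j - normalIndex s N) g) ∧
      ∀ f g : RatFunc ℂ, IsPade s (normalIndex s j) (normalIndex s j) f →
        IsPade (induced s N)
          (normalIndex s j - normalIndex s N) (normalIndex s j - normalIndex s N) g →
        lftDenom ((resolventMatrix s N).map toRat) g ≠ 0 ∧
          f = lft ((resolventMatrix s N).map toRat) g) ∧
    ((∃! f : RatFunc ℂ, IsPade s (normalIndex s j) (normalIndex s j - 1) f) ∧
      (∃! g : RatFunc ℂ, IsPade (induced s N)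
        (normalIndex s j - normalIndex s N) (normalIndex s j - normalIndex s N - 1) g) ∧
      ∀ f g : RatFunc ℂ, IsPade s (normalIndex s j) (normalIndex s j - 1) f →
        IsPade (induced s N)
          (normalIndex s j - normalIndex s N) (normalIndex s j - normalIndex s N - 1) g →
        lftDenom ((resolventMatrix s N).map toRat) g ≠ 0 ∧
          f = lft ((resolventMatrix s N).map toRat) g) := by
  classical
  have hcard := lt_card_of_le_encard_normalIndices hj
  have hdet : (hankel s (normalIndex s j)).det ≠ 0 := Nat.nth_mem j hcard
  have hcount : Nat.count (fun n => (hankel s n).det ≠ 0) (normalIndex s j) = j :=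
    Nat.count_nth hcard
  obtain ⟨hreg, hstep, hnormal, hoff⟩ := normal_schurOffset hs.regular hdet hcount hNj.le
  -- The offset has nonzero determinant and exactly `N` such indices, counting `0`, below it.
  have hNth : normalIndex s N = schurOffset s N := by
    have h : (hankel s (schurOffset s N)).det ≠ 0 := by
      have := hnormal 0
      rw [add_zero] at this
      rw [ne_eq, this]
      simp
    have := Nat.nth_count (p := fun n => (hankel s n).det ≠ 0) h
    rwa [hoff] at this
  have hlt : schurOffset s N < normalIndex s j :=
    Nat.lt_of_count_lt_count (p := fun n => (hankel s n).det ≠ 0) (by rw [hoff, hcount]; exact hNj)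
  rw [hNth]
  obtain ⟨m, hm⟩ := Nat.exists_eq_add_of_le' hlt.le
  rw [hm, Nat.add_sub_cancel]
  have hm1 : 1 ≤ m := by omega
  have hmdet : (hankel (induced s N) m).det ≠ 0 := by
    rw [ne_eq, ← hnormal, add_comm, ← hm]
    exact hdet
  constructor
  · obtain ⟨P, Q, h⟩ := exists_approximant hreg hmdet
    have h' := h.resolvent hstep
    exact pade_transform hstep h
      (h.isPade le_rfl h.natDegree_reflect_le)
      (h'.isPade (by push_cast; omega)
        h'.natDegree_reflect_le)
  · obtain ⟨P, Q, h, h0⟩ := exists_approximant_eval_zero hreg hm1 hmdet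
    have h' := h.resolvent hstep
    have h0' : ((stieltjesP s N).1 * Q + (stieltjesP s N).2 * P).eval 0 = 0 := by
      simp [eval_zero_stieltjesP, h0]
    exact pade_transform hstep h
      (h.isPade (by omega) (h.natDegree_reflect_le_sub_one h0))
      (h'.isPade (by omega) (h'.natDegree_reflect_le_sub_one h0'))
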